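/- Let $p$ be a prime and let all arithmetic on inputs and outputs be modulo $p$. A ($p$-nary-input, $p$-nary-output) box $P$ is a family of probability distributions $P(a,b|x,y)$, $a,b,x,y\in\mathbb{Z}_p$; it is no-signalling if $\sum_b P(a,b|x,y)$ does not depend on $y$ and $\sum_a P(a,b|x,y)$ does not depend on $x$. Consider a world in which the boxes of some set $W$ of no-signalling boxes are available in arbitrarily many copies. Information causality holds in it if the following is true for all $N,m\ge 0$. Suppose Alice holds independent uniformly random digits $x_0,\dots,x_{N-1}\in\mathbb{Z}_p$ and Bob holds an index $y\in\{0,\dots,N-1\}$; they use shared randomness and finitely many boxes from $W$ (each party choosing its inputs, and the order in which it uses the boxes, adaptively), Alice sends $m$ $p$-nary digits to Bob, and Bob outputs $b\in\mathbb{Z}_p$. Then, whatever protocol they follow, $\sum_{i=0}^{N-1} I(x_i:b\,|\,y=i)\le m\log p$, where $I$ is the Shannon mutual information. A function $f:\mathbb{Z}_p\times\mathbb{Z}_p\to\mathbb{Z}_p$ is additively inseparable if it is not of the form $g(x)+h(y)$. Writing $f(x,y)=\sum_{i,j=0}^{p-1}\lambda_{i,j}x^iy^j$, let $\Delta(f)$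 be the maximum of $i+j$ over all $i,j\ge1$ with $\lambda_{i,j}\ne0$ (and $0$ if there are none). Let $\omega_p=e^{2\pi i/p}$, and let $T_p(x)=h(x)+(1-x)\log(p-1)$ with $h(x)=-x\log x-(1-x)\log(1-x)$; on $[1/p,1]$ the function $T_p$ decreases strictly from $\log p$ to $0$, and $T_p^{-1}:[0,\log p]\to[1/p,1]$ denotes the inverse of this restriction. Theorem. Suppose that information causality holds in the world $W$. Let $f:\mathbb{Z}_p\times\mathbb{Z}_p\to\mathbb{Z}_p$ be additively inseparable with $\Delta(f)=2$, let $P\in W$, and put $$\nu_j=\frac1{p^2}\sum_{x,y\in\mathbb{Z}_p}P(a-b=f(x,y)-j\,|\,x,y)=\frac1{p^2}\sum_{x,y,k\in\mathbb{Z}_p}P(k,\,k-f(x,y)+j\,|\,x,y),\qquad j\in\mathbb{Z}_p.$$ Then the left-hand sides below are real numbers, and 1. for all integers $N$ with $1\le N\le p$ and all $c\in\mathbb{Z}_p$, $$\frac1p\sum_{k=0}^{p-1}\omega_p^{ck}\Bigl(\sum_{j=0}^{p-1}\nu_j\omega_p^{jk}\Bigr)^{N-1}\le T_p^{-1}\Bigl(\frac{N-1}{N}\log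 p\Bigr);$$ 2. for all integers $n\ge1$, with $N=p^n$, and all $c\in\mathbb{Z}_p$, $$\frac1p\sum_{k=0}^{p-1}\omega_p^{ck}\Bigl(\sum_{j=0}^{p-1}\nu_j\omega_p^{jk}\Bigr)^{n(p-1)}\le T_p^{-1}\Bigl(\frac{N-1}{N}\log p\Bigr).$$ (Here $z^0=1$ for every $z$.) -/

import Mathlib

/-- A bipartite correlation box with inputs and outputs in `ZMod p`:
`prob a b x y` is the probability `P(a, b | x, y)`. -/
structure Box (p : ℕ) [NeZero p] where
  prob : ZMod p → ZMod p → ZMod p → ZMod p → ℝ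
  nonneg : ∀ a b x y, 0 ≤ prob a b x y
  sum_eq_one : ∀ x y, ∑ a, ∑ b, prob a b x y = 1

/-- Neither party can signal to the other through the choice of its input. -/
def Box.NoSignalling {p : ℕ} [NeZero p] (P : Box p) : Prop :=
  (∀ a x y y', ∑ b, P.prob a b x y = ∑ b, P.prob a b x y') ∧
  (∀ b x x' y, ∑ a, P.prob a b x y = ∑ a, P.prob a b x' y)

/-- The way in which one party uses its ends of a family of boxes indexed by `ι`, each box once.
If `o` is the vector of outputs that the party obtains, then `input o i` is what it feeds into
box `i`, at time `time o i`. The field `causal` says that the time and the input depend only on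
the outputs obtained strictly earlier: the order of use and the inputs may be chosen adaptively.
(A box that the party does not need is used at the end, its output being ignored.) -/
structure LocalWiring (p : ℕ) (ι : Type) where
  time : (ι → ZMod p) → ι → ℕ
  input : (ι → ZMod p) → ι → ZMod p
  causal : ∀ o o' i, (∀ j, time o j < time o i → o' j = o j) →
    time o' i = time o i ∧ input o' i = input o i

/-- A protocol for the random access task: Alice holds `N` digits, Bob holds an index, Alice sends
`m` digits to Bob, and Bob outputs a digit. They share a finite random variable (which also
provides any private randomness) and finitely many boxes taken from `W`. -/
structure RACProtocol {p : ℕ} [NeZero p] (W : Set (Box p)) (N m : ℕ) where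
  ι : Type
  fintypeι : Fintype ι
  decEqι : DecidableEq ι
  box : ι → Box p
  box_mem : ∀ i, box i ∈ W
  R : Type
  fintypeR : Fintype R
  weight : R → ℝ
  weight_nonneg : ∀ r, 0 ≤ weight r
  weight_sum : ∑ r, weight r = 1
  alice : R → (Fin N → ZMod p) → LocalWiring p ι
  message : R → (Fin N → ZMod p) → (ι → ZMod p) → (Fin m → ZMod p)
  bob : R → Fin N → (Fin m → ZMod p) → LocalWiring p ι
  guess : R → Fin N → (Fin m → ZMod p) → (ι → ZMod p) → ZMod p

attribute [instance] RACProtocol.fintypeι RACProtocol.decEqι RACProtocol.fintypeR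

/-- The probability that Bob outputs `v` when Alice holds the digits `x` and Bob the index `y`;
`s` and `t` are the vectors of outputs that Alice and Bob obtain from the boxes. -/
noncomputable def RACProtocol.guessProb {p : ℕ} [NeZero p] {W : Set (Box p)} {N m : ℕ}
    (π : RACProtocol W N m) (x : Fin N → ZMod p) (y : Fin N) (v : ZMod p) : ℝ :=
  ∑ r : π.R, π.weight r * ∑ s : π.ι → ZMod p, ∑ t : π.ι → ZMod p,
    if π.guess r y (π.message r x s) t = v then
      ∏ i, (π.box i).prob (s i) (t i) ((π.alice r x).input s i)
        ((π.bob r y (π.message r x s)).input t i)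
    else 0

/-- The joint distribution of Alice's digit `x i` and Bob's output, given that Bob's index is `i`,
when Alice's digits are independent and uniformly random. -/
noncomputable def RACProtocol.joint {p : ℕ} [NeZero p] {W : Set (Box p)} {N m : ℕ}
    (π : RACProtocol W N m) (i : Fin N) (u v : ZMod p) : ℝ :=
  1 / (p : ℝ) ^ N * ∑ x : Fin N → ZMod p, if x i = u then π.guessProb x i v else 0

/-- Shannon mutual information (in nats) of a joint distribution on `α × β`. -/
noncomputable def mutualInfo {α β : Type} [Fintype α] [Fintype β] (q : α → β → ℝ) : ℝ :=
  ∑ a, ∑ b, q a b * Real.log (q a b / ((∑ b', q a b') * ∑ a', q a' b))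

/-- Information causality in a world whose boxes are those in `W`: whatever protocol is used,
if Alice sends `m` digits then `∑ i, I(x i : b | y = i) ≤ m log p`. -/
def InformationCausality {p : ℕ} [NeZero p] (W : Set (Box p)) : Prop :=
  ∀ (N m : ℕ) (π : RACProtocol W N m),
    ∑ i : Fin N, mutualInfo (π.joint i) ≤ m * Real.log p

/-- `f` is a sum of a function of `x` and a function of `y`. -/
def AdditivelySeparable {p : ℕ} (f : ZMod p → ZMod p → ZMod p) : Prop :=
  ∃ g h : ZMod p → ZMod p, ∀ x y, f x y = g x + h y

/-- The function `(x, y) ↦ ∑ i j, l i j * x ^ i * y ^ j` with exponents at most `p - 1`. -/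
def polyFun {p : ℕ} (l : Fin p → Fin p → ZMod p) (x y : ZMod p) : ZMod p :=
  ∑ i : Fin p, ∑ j : Fin p, l i j * x ^ (i : ℕ) * y ^ (j : ℕ)

theorem coeff_eq_zero {p : ℕ} [Fact p.Prime] (c : Fin p → ZMod p)
    (hc : ∀ x : ZMod p, ∑ i : Fin p, c i * x ^ (i : ℕ) = 0) : c = 0 := by
  have hp : NeZero p := ⟨(Fact.out : p.Prime).ne_zero⟩
  let v : Fin p → ZMod p := fun k => ((k : ℕ) : ZMod p)
  have hv : Function.Injective v := by
    intro a b hab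
    have h1 : ((a : ℕ) : ZMod p) = ((b : ℕ) : ZMod p) := hab
    have h2 := congrArg ZMod.val h1
    rw [ZMod.val_natCast_of_lt a.2, ZMod.val_natCast_of_lt b.2] at h2
    exact Fin.ext h2
  refine Matrix.eq_zero_of_mulVec_eq_zero (M := Matrix.vandermonde v)
    (Matrix.det_vandermonde_ne_zero_iff.mpr hv) ?_
  ext k
  have := hc (v k)
  simpa [Matrix.mulVec, dotProduct, Matrix.vandermonde_apply, mul_comm] using this

theorem polyFun_injective {p : ℕ} [Fact p.Prime] :
    Function.Injective (polyFun : (Fin p → Fin p → ZMod p) → ZMod p → ZMod p → ZMod p) := by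
  intro l l' h
  have h1 : ∀ y x : ZMod p,
      ∑ i : Fin p, (∑ j : Fin p, (l i j - l' i j) * y ^ (j : ℕ)) * x ^ (i : ℕ) = 0 := by
    intro y x
    have h2 : polyFun l x y - polyFun l' x y = 0 := by rw [h, sub_self]
    rw [← h2]
    simp only [polyFun, ← Finset.sum_sub_distrib, Finset.sum_mul]
    refine Finset.sum_congr rfl fun i _ => Finset.sum_congr rfl fun j _ => ?_
    ring
  funext i j
  have h3 : (fun j => l i j - l' i j) = 0 :=
    coeff_eq_zero _ fun y => congrFun (coeff_eq_zero _ (h1 y)) i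
  exact sub_eq_zero.mp (congrFun h3 j)

/-- Every `f` is represented by exactly one array of coefficients. -/
theorem existsUnique_polyFun {p : ℕ} [Fact p.Prime] (f : ZMod p → ZMod p → ZMod p) :
    ∃! l : Fin p → Fin p → ZMod p, polyFun l = f := by
  have hp : NeZero p := ⟨(Fact.out : p.Prime).ne_zero⟩
  have hb : Function.Bijective
      (polyFun : (Fin p → Fin p → ZMod p) → ZMod p → ZMod p → ZMod p) := by
    rw [Fintype.bijective_iff_injective_and_card]
    exact ⟨polyFun_injective, by simp [ZMod.card]⟩
  exact hb.existsUnique f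

/-- The coefficients of `f` as a polynomial of degree at most `p - 1` in each variable. -/
noncomputable def polyCoeff {p : ℕ} [Fact p.Prime] (f : ZMod p → ZMod p → ZMod p) :
    Fin p → Fin p → ZMod p :=
  (existsUnique_polyFun f).choose

theorem polyFun_polyCoeff {p : ℕ} [Fact p.Prime] (f : ZMod p → ZMod p → ZMod p) :
    polyFun (polyCoeff f) = f :=
  (existsUnique_polyFun f).choose_spec.1

/-- The largest degree `i + j` of a term `x ^ i * y ^ j`, `i, j ≥ 1`, that occurs in `f`
(`0` if there is none). -/
noncomputable def mixedDegree {p : ℕ} [Fact p.Prime] (f : ZMod p → ZMod p → ZMod p) : ℕ :=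
  Finset.univ.sup fun ij : Fin p × Fin p =>
    if 1 ≤ (ij.1 : ℕ) ∧ 1 ≤ (ij.2 : ℕ) ∧ polyCoeff f ij.1 ij.2 ≠ 0
    then (ij.1 : ℕ) + (ij.2 : ℕ) else 0

/-- `ν_j`: the average over `(x, y)` of `P(a - b = f(x, y) - j | x, y)`. -/
noncomputable def boxShift {p : ℕ} [NeZero p] (P : Box p) (f : ZMod p → ZMod p → ZMod p)
    (j : ZMod p) : ℝ :=
  1 / (p : ℝ) ^ 2 * ∑ x, ∑ y, ∑ k, P.prob k (k - f x y + j) x y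

/-- `ω_p = exp(2πi / p)`. -/
noncomputable def omega (p : ℕ) : ℂ := Complex.exp (2 * Real.pi * Complex.I / p)

/-- `(1/p) ∑_k ω^{ck} (∑_j ν_j ω^{jk})^M`. -/
noncomputable def charSum {p : ℕ} [NeZero p] (ν : ZMod p → ℝ) (M : ℕ) (c : ZMod p) : ℂ :=
  1 / (p : ℂ) * ∑ k ∈ Finset.range p, omega p ^ (c.val * k) *
    (∑ j : ZMod p, (ν j : ℂ) * omega p ^ (j.val * k)) ^ M

/-- `T_p(x) = h(x) + (1 - x) log (p - 1)` with `h` the binary entropy function. -/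
noncomputable def fanoT (p : ℕ) (x : ℝ) : ℝ :=
  Real.binEntropy x + (1 - x) * Real.log ((p : ℝ) - 1)

/-- `T_p` is a bijection from `[1/p, 1]` onto `[0, log p]`. -/
theorem fanoT_existsUnique {p : ℕ} (hp : 2 ≤ p) {y : ℝ} (hy : y ∈ Set.Icc 0 (Real.log p)) :
    ∃! x, x ∈ Set.Icc (1 / (p : ℝ)) 1 ∧ fanoT p x = y := by
  have hp0 : (0 : ℝ) < p := by positivity
  have hp1 : (1 : ℝ) < p := by exact_mod_cast hp
  have hle : 1 / (p : ℝ) ≤ 1 := by rw [div_le_one hp0]; exact hp1.le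
  have hq : ∀ x, fanoT p x = Real.qaryEntropy p (1 - x) := by
    intro x
    simp only [fanoT, Real.qaryEntropy, Real.binEntropy_one_sub]
    push_cast
    ring
  have h1 : fanoT p 1 = 0 := by simp [fanoT]
  have h2 : fanoT p (1 / (p : ℝ)) = Real.log p := by
    have hne : (p : ℝ) - 1 ≠ 0 := by linarith
    have h3 : (1 : ℝ) - 1 / p = (p - 1) / p := by field_simp
    simp only [fanoT, Real.binEntropy, h3, inv_div, div_one,
      Real.log_div hp0.ne' hne]
    rw [one_div]
    field_simp
    ring
  have hcont : Continuous (fanoT p) := by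
    have : fanoT p = fun x => Real.qaryEntropy p (1 - x) := funext hq
    rw [this]; fun_prop
  have hanti : Set.InjOn (fanoT p) (Set.Icc (1 / (p : ℝ)) 1) := by
    intro a ha b hb hab
    rw [hq, hq] at hab
    have := (Real.qaryEntropy_strictMonoOn hp).injOn
      (x₁ := 1 - a) (x₂ := 1 - b) ⟨by linarith [ha.2], by linarith [ha.1]⟩
      ⟨by linarith [hb.2], by linarith [hb.1]⟩ hab
    linarith
  obtain ⟨x, hx, hxy⟩ := intermediate_value_Icc' hle hcont.continuousOn
    (by rw [h1, h2]; exact hy : y ∈ Set.Icc (fanoT p 1) (fanoT p (1 / (p : ℝ))))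
  exact ⟨x, ⟨hx, hxy⟩, fun z hz => hanti hz.1 hx (hz.2.trans hxy.symm)⟩

/-- The inverse of `T_p` on `[1/p, 1]`, where `T_p` decreases strictly from `log p` to `0`. -/
noncomputable def fanoTInv (p : ℕ) (y : ℝ) : ℝ :=
  Function.invFunOn (fanoT p) (Set.Icc (1 / (p : ℝ)) 1) y

open Finset

/-! Degree two together with inseparability forces `f x y = g x + h y + l * x * y` with `l ≠ 0`, so
a copy of `P` acts as a noisy multiplier between Alice and Bob.

For a node with `d + 1` children, Alice feeds `d` boxes with `l⁻¹` times the differences of the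
other children from child `0`, and Bob feeds `1` into the box of the wanted child and `0` elsewhere.
The outputs let Alice form one digit from which Bob can recover any one child. Iterating over `n`
levels compresses `(d + 1) ^ n` digits into a single message, and retrieval of a leaf involves `n *
d` boxes. Uniform shared masks on all inputs make the errors of the boxes independent with law
`boxShift P f`, whatever the data (`sum_prod_prob_eq_sum_prod_boxShift`). Bob's total error is their
sum (`nodeDigit_root_sub`), whose law is `charSum` by Fourier inversion (`charSum_eq_sum_prod`).

Since the error law `μ` is the same for every leaf, information causality with one sent digit reads
`N * (log p - H(μ)) ≤ log p`. Fano's inequality bounds `H(μ)` by `fanoT` of any single `μ e`, and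
inverting `fanoT` gives the claim. -/

/-! ### Normal form of functions of mixed degree two -/

theorem exists_eq_add_add_mul_of_mixedDegree_eq_two {p : ℕ} [Fact p.Prime]
    {f : ZMod p → ZMod p → ZMod p} (hf : ¬ AdditivelySeparable f) (hdeg : mixedDegree f = 2) :
    ∃ (g h : ZMod p → ZMod p) (l : ZMod p), l ≠ 0 ∧ ∀ x y, f x y = g x + h y + l * x * y := by
  have h2 : 1 < p := (Fact.out : p.Prime).one_lt
  let one : Fin p := ⟨1, h2⟩
  have hcoeff : ∀ i j : Fin p, 1 ≤ (i : ℕ) → 1 ≤ (j : ℕ) → (i, j) ≠ (one, one) →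
      polyCoeff f i j = 0 := by
    intro i j hi hj hij
    by_contra hne
    have hle := Finset.le_sup (f := fun ij : Fin p × Fin p =>
      if 1 ≤ (ij.1 : ℕ) ∧ 1 ≤ (ij.2 : ℕ) ∧ polyCoeff f ij.1 ij.2 ≠ 0
      then (ij.1 : ℕ) + (ij.2 : ℕ) else 0) (Finset.mem_univ (i, j))
    rw [← mixedDegree, hdeg] at hle
    simp only [hi, hj, hne, ne_eq, not_false_eq_true, and_self, if_true] at hle
    exact hij (Prod.ext (Fin.ext (by simp only [one]; omega)) (Fin.ext (by simp only [one]; omega)))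
  -- The mixed second difference kills every monomial in one variable only; the sole surviving term
  -- is `x * y`.
  have hmixed : ∀ x y, f x y - f x 0 - f 0 y + f 0 0 = polyCoeff f one one * x * y := by
    intro x y
    have hexp : ∀ x y, f x y =
        ∑ ij : Fin p × Fin p, polyCoeff f ij.1 ij.2 * x ^ (ij.1 : ℕ) * y ^ (ij.2 : ℕ) := by
      intro x y
      rw [Fintype.sum_prod_type]
      exact (congrFun (congrFun (polyFun_polyCoeff f) x) y).symm
    rw [hexp x y, hexp x 0, hexp 0 y, hexp 0 0, ← Finset.sum_sub_distrib,
      ← Finset.sum_sub_distrib, ← Finset.sum_add_distrib, Finset.sum_eq_single (one, one)]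
    · simp [one]
    · rintro ⟨i, j⟩ - hij
      rcases Nat.eq_zero_or_pos (i : ℕ) with hi | hi
      · simp [hi]
      rcases Nat.eq_zero_or_pos (j : ℕ) with hj | hj
      · simp [hj]
      · simp [hcoeff i j hi hj hij]
    · simp
  refine ⟨fun x => f x 0, fun y => f 0 y - f 0 0, polyCoeff f one one, fun h0 => hf ?_, ?_⟩
  · refine ⟨fun x => f x 0, fun y => f 0 y - f 0 0, fun x y => ?_⟩
    have := hmixed x y
    rw [h0] at this
    linear_combination this
  · intro x y
    linear_combination hmixed x y

/-! ### Entropy: inverting `fanoT`, Fano's inequality, mutual information -/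

theorem fanoT_eq_qaryEntropy (p : ℕ) (x : ℝ) : fanoT p x = Real.qaryEntropy p (1 - x) := by
  simp only [fanoT, Real.qaryEntropy, Real.binEntropy_one_sub]
  push_cast
  ring

theorem fanoT_strictAntiOn {p : ℕ} (hp : 2 ≤ p) :
    StrictAntiOn (fanoT p) (Set.Icc (1 / (p : ℝ)) 1) := by
  intro a ha b hb hab
  rw [fanoT_eq_qaryEntropy, fanoT_eq_qaryEntropy]
  exact Real.qaryEntropy_strictMonoOn hp ⟨by linarith [hb.2], by linarith [hb.1]⟩
    ⟨by linarith [ha.2], by linarith [ha.1]⟩ (by linarith)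

theorem le_fanoTInv {p : ℕ} (hp : 2 ≤ p) {x y : ℝ} (hx : x ≤ 1)
    (hy : y ∈ Set.Icc 0 (Real.log p)) (hxy : y ≤ fanoT p x) : x ≤ fanoTInv p y := by
  obtain ⟨z, hz, -⟩ := fanoT_existsUnique hp hy
  have hmem : fanoTInv p y ∈ Set.Icc (1 / (p : ℝ)) 1 := Function.invFunOn_mem ⟨z, hz.1, hz.2⟩
  have heq : fanoT p (fanoTInv p y) = y := Function.invFunOn_eq ⟨z, hz.1, hz.2⟩
  -- A value `x` below `1 / p` needs no separate case: `fanoTInv p y < x` already puts `x` in the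
  -- interval of monotonicity.
  by_contra! hlt
  have := fanoT_strictAntiOn hp hmem ⟨hmem.1.trans hlt.le, hx⟩ hlt
  linarith

/-- Fano's inequality: the entropy of a distribution on `p` points is at most `T_p` of the
probability of any one of them. -/
theorem sum_negMulLog_le_fanoT {α : Type*} [Fintype α] [DecidableEq α] {p : ℕ} (hp : 2 ≤ p)
    (hcard : Fintype.card α = p) {μ : α → ℝ} (hμ : ∀ a, 0 ≤ μ a) (hsum : ∑ a, μ a = 1) (a : α) :
    ∑ b, Real.negMulLog (μ b) ≤ fanoT p (μ a) := by
  have hp1 : (0 : ℝ) < (p : ℝ) - 1 := by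
    have : (2 : ℝ) ≤ p := by exact_mod_cast hp
    linarith
  have hc : ((univ.erase a).card : ℝ) = p - 1 := by
    rw [Finset.card_erase_of_mem (mem_univ a), Finset.card_univ, hcard,
      Nat.cast_sub (by omega), Nat.cast_one]
  have hs : ∑ b ∈ univ.erase a, μ b = 1 - μ a := by
    rw [← hsum, ← Finset.add_sum_erase univ μ (mem_univ a)]
    ring
  -- Jensen with equal weights on the `p - 1` other points: spreading the mass `1 - μ a` evenly
  -- maximises the entropy.
  have hJ := Real.concaveOn_negMulLog.le_map_sum (t := univ.erase a)
    (w := fun _ => ((p : ℝ) - 1)⁻¹) (p := μ) (fun _ _ => by positivity)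
    (by rw [Finset.sum_const, nsmul_eq_mul, hc, mul_inv_cancel₀ hp1.ne'])
    (fun b _ => hμ b)
  simp only [smul_eq_mul, ← Finset.mul_sum, hs] at hJ
  rw [inv_mul_le_iff₀ hp1] at hJ
  rw [← Finset.add_sum_erase univ _ (mem_univ a)]
  have hT : fanoT p (μ a) =
      Real.negMulLog (μ a) + (p - 1) * Real.negMulLog (((p : ℝ) - 1)⁻¹ * (1 - μ a)) := by
    rw [fanoT, Real.binEntropy_eq_negMulLog_add_negMulLog_one_sub, Real.negMulLog_mul]
    simp only [Real.negMulLog, Real.log_inv]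
    field_simp
    ring
  linarith

/-- Two variables on an abelian group, the first uniform and their difference independent of it. -/
theorem mutualInfo_of_sub {G : Type} [Fintype G] [AddCommGroup G] {μ : G → ℝ}
    (hsum : ∑ e, μ e = 1) :
    mutualInfo (fun u v : G => 1 / (Fintype.card G : ℝ) * μ (u - v)) =
      Real.log (Fintype.card G) - ∑ e, Real.negMulLog (μ e) := by
  have hn : (Fintype.card G : ℝ) ≠ 0 := by exact_mod_cast Fintype.card_ne_zero
  set n : ℝ := (Fintype.card G : ℝ) with hndef
  have h1 : ∀ (φ : G → ℝ) u, ∑ v, φ (u - v) = ∑ e, φ e :=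
    fun φ u => Equiv.sum_comp (Equiv.subLeft u) φ
  have h2 : ∀ (φ : G → ℝ) v, ∑ u, φ (u - v) = ∑ e, φ e :=
    fun φ v => Equiv.sum_comp (Equiv.subRight v) φ
  have h3 : ∀ e, 1 / n * μ e * Real.log (1 / n * μ e / (1 / n * (1 / n))) =
      1 / n * (μ e * Real.log n - Real.negMulLog (μ e)) := by
    intro e
    by_cases h0 : μ e = 0
    · simp [h0]
    · have : 1 / n * μ e / (1 / n * (1 / n)) = n * μ e := by field_simp
      rw [this, Real.log_mul hn h0, Real.negMulLog]
      ring
  simp only [mutualInfo, ← Finset.mul_sum, h1 μ, h2 μ, hsum, mul_one, h3,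
    h1 (fun e => μ e * Real.log n - Real.negMulLog (μ e)), Finset.sum_sub_distrib, ← Finset.sum_mul]
  simp only [Finset.sum_const, Finset.card_univ, nsmul_eq_mul, ← hndef]
  field_simp

/-! ### Fourier inversion for sums of independent shifts -/

theorem omega_pow_val_mul {p : ℕ} [NeZero p] (c : ZMod p) (k : ℕ) :
    omega p ^ (c.val * k) = ZMod.stdAddChar ((k : ZMod p) * c) := by
  have h : (k : ZMod p) * c = ((c.val * k : ℕ) : ℤ) := by
    push_cast
    rw [ZMod.natCast_zmod_val, mul_comm]
  rw [h, ZMod.stdAddChar_coe, omega, ← Complex.exp_nat_mul]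
  congr 1
  push_cast
  ring

theorem charSum_eq_sum_stdAddChar {p : ℕ} [NeZero p] (ν : ZMod p → ℝ) (M : ℕ) (c : ZMod p) :
    charSum ν M c = 1 / (p : ℂ) * ∑ k : ZMod p, ZMod.stdAddChar (k * c) *
      (∑ j : ZMod p, (ν j : ℂ) * ZMod.stdAddChar (k * j)) ^ M := by
  rw [charSum]
  congr 1
  simp only [omega_pow_val_mul]
  refine Finset.sum_bij' (fun k _ => (k : ZMod p)) (fun k _ => k.val) (by simp)
    (fun k _ => Finset.mem_range.mpr k.val_lt)
    (fun k hk => ZMod.val_cast_of_lt (Finset.mem_range.mp hk)) (by simp) (by simp)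

/-- If the `j i` are independent with distribution `ν`, then `charSum` gives the distribution of
the sum of `M` of them. -/
theorem charSum_eq_sum_prod {p : ℕ} [Fact p.Prime] {ι κ : Type*} [Fintype ι] [DecidableEq ι]
    [Fintype κ] (e : κ ↪ ι) {ν : ZMod p → ℝ} (hν : ∑ j, ν j = 1) {M : ℕ}
    (hM : Fintype.card κ = M) (c : ZMod p) :
    charSum ν M c =
      ((∑ j : ι → ZMod p, if ∑ a, j (e a) = -c then ∏ i, ν (j i) else 0 : ℝ) : ℂ) := by
  have hp0 : (p : ℂ) ≠ 0 := by exact_mod_cast (Fact.out : p.Prime).ne_zero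
  have hν' : ∑ j, (ν j : ℂ) = 1 := by exact_mod_cast hν
  have hpow : ∀ k : ZMod p, (∑ j : ZMod p, (ν j : ℂ) * ZMod.stdAddChar (k * j)) ^ M =
      ∑ j : ι → ZMod p, (∏ i, (ν (j i) : ℂ)) * ZMod.stdAddChar (k * ∑ a, j (e a)) := by
    intro k
    -- The indices outside the range of `e` carry the factor `∑ j, ν j = 1`, so only the `M`
    -- selected ones contribute a characteristic function.
    let φ : ι → ZMod p → ℂ := fun i j =>
      (ν j : ℂ) * if i ∈ univ.map e then ZMod.stdAddChar (k * j) else 1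
    have h1 : ∏ i, ∑ j, φ i j = (∑ j : ZMod p, (ν j : ℂ) * ZMod.stdAddChar (k * j)) ^ M := by
      have h : ∀ i, ∑ j, φ i j = if i ∈ univ.map e then
          ∑ j : ZMod p, (ν j : ℂ) * ZMod.stdAddChar (k * j) else 1 := by
        intro i
        by_cases hi : i ∈ univ.map e
        · simp only [φ, hi, if_true]
        · simp only [φ, hi, if_false, mul_one, hν']
      simp only [h]
      rw [Finset.prod_ite_mem, Finset.univ_inter, Finset.prod_const, Finset.card_map,
        Finset.card_univ, hM]
    rw [← h1, Finset.prod_univ_sum, Fintype.piFinset_univ]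
    refine Finset.sum_congr rfl fun j _ => ?_
    simp only [φ]
    rw [Finset.prod_mul_distrib, Finset.prod_ite_mem, Finset.univ_inter, Finset.prod_map,
      Finset.mul_sum]
    exact congrArg _ (map_prod (ZMod.stdAddChar (N := p)).toMonoidHom
      (fun a => Multiplicative.ofAdd (k * j (e a))) univ).symm
  rw [charSum_eq_sum_stdAddChar]
  simp only [hpow, Finset.mul_sum]
  rw [Finset.sum_comm]
  push_cast
  refine Finset.sum_congr rfl fun j _ => ?_
  -- Orthogonality of characters. The exponent in `charSum` is `+ck`, hence the event is that the
  -- sum equals `-c`.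
  have h2 : ∑ k : ZMod p, (ZMod.stdAddChar (k * (c + ∑ a, j (e a))) : ℂ) =
      if c + ∑ a, j (e a) = 0 then (p : ℂ) else 0 := by
    rw [AddChar.sum_mulShift _ (ZMod.isPrimitive_stdAddChar p), ZMod.card]
    split_ifs <;> simp
  have h3 : ∀ k : ZMod p, 1 / (p : ℂ) * (ZMod.stdAddChar (k * c) *
      ((∏ i, (ν (j i) : ℂ)) * ZMod.stdAddChar (k * ∑ a, j (e a)))) =
      1 / (p : ℂ) * (∏ i, (ν (j i) : ℂ)) * ZMod.stdAddChar (k * (c + ∑ a, j (e a))) := by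
    intro k
    rw [mul_add, AddChar.map_add_eq_mul]
    ring
  simp only [Finset.mul_sum] at h3
  rw [Finset.sum_congr rfl fun k _ => h3 k, ← Finset.mul_sum, h2]
  have h4 : c + ∑ a, j (e a) = 0 ↔ ∑ a, j (e a) = -c := by
    rw [eq_neg_iff_add_eq_zero, add_comm]
  simp only [h4]
  split_ifs
  · push_cast
    field_simp
  · simp

/-! ### Masked boxes and the law of their shifts -/

theorem boxShift_nonneg {p : ℕ} [NeZero p] (P : Box p) (f : ZMod p → ZMod p → ZMod p)
    (j : ZMod p) : 0 ≤ boxShift P f j :=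
  mul_nonneg (by positivity) <| Finset.sum_nonneg fun _ _ => Finset.sum_nonneg fun _ _ =>
    Finset.sum_nonneg fun _ _ => P.nonneg _ _ _ _

theorem sum_boxShift {p : ℕ} [NeZero p] (P : Box p) (f : ZMod p → ZMod p → ZMod p) :
    ∑ j, boxShift P f j = 1 := by
  have hp0 : (p : ℝ) ≠ 0 := by exact_mod_cast NeZero.ne p
  simp only [boxShift, ← Finset.mul_sum]
  have h : ∑ j, ∑ x, ∑ y, ∑ k, P.prob k (k - f x y + j) x y =
      ∑ x : ZMod p, ∑ y : ZMod p, (1 : ℝ) := by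
    rw [Finset.sum_comm]
    refine Finset.sum_congr rfl fun x _ => ?_
    rw [Finset.sum_comm]
    refine Finset.sum_congr rfl fun y _ => ?_
    rw [Finset.sum_comm, ← P.sum_eq_one x y]
    exact Finset.sum_congr rfl fun k _ =>
      Equiv.sum_comp (Equiv.addLeft (k - f x y)) fun b => P.prob k b x y
  rw [h]
  simp [ZMod.card]
  field_simp

/-- Independent copies of a box, the inputs of which are masked by uniform shared randomness,
produce independent shifts. Alice's inputs may depend on the masks and on outputs, provided that
they remain a bijective function of her masks. -/
theorem sum_prod_prob_eq_sum_prod_boxShift {p : ℕ} [NeZero p] (P : Box p)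
    (f : ZMod p → ZMod p → ZMod p) {ι : Type*} [Fintype ι] [DecidableEq ι]
    (X : (ι → ZMod p) → (ι → ZMod p) → (ι → ZMod p) → ι → ZMod p)
    (hX : ∀ σ s, Function.Bijective fun ρ => X ρ σ s) (Y : ι → ZMod p)
    (G : (ι → ZMod p) → ℝ) :
    ∑ r : (ι → ZMod p) × (ι → ZMod p), (1 / (p : ℝ) ^ 2) ^ Fintype.card ι *
      ∑ s : ι → ZMod p, ∑ t : ι → ZMod p,
        G (fun i => f (X r.1 r.2 s i) (Y i + r.2 i) - s i + t i) *
          ∏ i, P.prob (s i) (t i) (X r.1 r.2 s i) (Y i + r.2 i) =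
      ∑ j : ι → ZMod p, G j * ∏ i, boxShift P f (j i) := by
  have hprod : ∀ j : ι → ZMod p, ∏ i, boxShift P f (j i) = (1 / (p : ℝ) ^ 2) ^ Fintype.card ι *
      ∑ x : ι → ZMod p, ∑ y : ι → ZMod p, ∑ s : ι → ZMod p,
        ∏ i, P.prob (s i) (s i - f (x i) (y i) + j i) (x i) (y i) := by
    intro j
    simp only [boxShift, Finset.prod_mul_distrib, Finset.prod_const, Finset.card_univ,
      Finset.prod_univ_sum, Fintype.piFinset_univ]
  simp only [hprod, ← Finset.mul_sum, mul_left_comm (G _)]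
  congr 1
  rw [Fintype.sum_prod_type, Finset.sum_comm]
  have hstep : ∀ σ : ι → ZMod p, ∑ ρ : ι → ZMod p, ∑ s : ι → ZMod p, ∑ t : ι → ZMod p,
        G (fun i => f (X ρ σ s i) (Y i + σ i) - s i + t i) *
          ∏ i, P.prob (s i) (t i) (X ρ σ s i) (Y i + σ i) =
      ∑ x : ι → ZMod p, ∑ s : ι → ZMod p, ∑ j : ι → ZMod p, G j *
          ∏ i, P.prob (s i) (s i - f (x i) ((Y + σ) i) + j i) (x i) ((Y + σ) i) := by
    intro σ
    -- With `σ` and `s` fixed, the masks `ρ` are exchanged for the inputs `x`, and then Bob's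
    -- outputs `t` for the shifts `j`. Fixing `s` first is what permits inputs that depend on
    -- outputs.
    refine Finset.sum_comm.trans (.trans (Finset.sum_congr rfl fun s _ => ?_) Finset.sum_comm)
    refine Fintype.sum_equiv (Equiv.ofBijective _ (hX σ s)) _ _ fun ρ => ?_
    refine Fintype.sum_equiv (Equiv.addLeft fun i => f (X ρ σ s i) (Y i + σ i) - s i) _ _
      fun t => ?_
    simp only [Equiv.coe_addLeft, Pi.add_apply, Equiv.ofBijective_apply]
    congr 1
    refine Finset.prod_congr rfl fun i _ => ?_
    congr 1
    ring
  rw [Finset.sum_congr rfl fun σ _ => hstep σ]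
  refine (Fintype.sum_equiv (Equiv.addLeft Y) _ (fun y => ∑ x : ι → ZMod p, ∑ s : ι → ZMod p,
    ∑ j : ι → ZMod p, G j *
      ∏ i, P.prob (s i) (s i - f (x i) (y i) + j i) (x i) (y i)) fun _ => rfl).trans ?_
  rw [Finset.sum_comm]
  simp only [Finset.mul_sum]
  conv_rhs => rw [Finset.sum_comm]
  refine Finset.sum_congr rfl fun x _ => ?_
  conv_rhs => rw [Finset.sum_comm]
  refine Finset.sum_congr rfl fun y _ => ?_
  rw [Finset.sum_comm]

/-! ### The pyramid of digits -/

/-- The boxes of a pyramid of depth `n` in which every node has `d + 1` children. The box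
`(k, w, a)` belongs to level `k`, and is used to retrieve child `a + 1` of node `w`. -/
abbrev PyramidBox (n d : ℕ) : Type := Fin n × (Fin n → Fin (d + 1)) × Fin d

section Pyramid

variable {p n d : ℕ} (g : ZMod p → ZMod p) (l : ZMod p)
  (x : (Fin n → Fin (d + 1)) → ZMod p) (ρ σ s : PyramidBox n d → ZMod p)

/-- The digit that Alice computes for node `w` at level `k`, from her data `x`, the masks `ρ` and
`σ` and the outputs `s` of her boxes. -/
def nodeDigit : ℕ → (Fin n → Fin (d + 1)) → ZMod p
  | 0, w => x w
  | k + 1, w =>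
    if hk : k < n then
      nodeDigit k (Function.update w ⟨k, hk⟩ 0) + ∑ a : Fin d,
        -- Subtracted from the output are the parts of `f` that Alice can evaluate: `g` of her
        -- input, and `l` times her input times Bob's mask.
        (s (⟨k, hk⟩, w, a) -
          g (l⁻¹ * (nodeDigit k (Function.update w ⟨k, hk⟩ a.succ) -
            nodeDigit k (Function.update w ⟨k, hk⟩ 0)) + ρ (⟨k, hk⟩, w, a)) -
          l * (l⁻¹ * (nodeDigit k (Function.update w ⟨k, hk⟩ a.succ) -
            nodeDigit k (Function.update w ⟨k, hk⟩ 0)) + ρ (⟨k, hk⟩, w, a)) * σ (⟨k, hk⟩, w, a))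
    else nodeDigit k w

/-- Alice's input to box `i`. -/
def pyramidInput (i : PyramidBox n d) : ZMod p :=
  l⁻¹ * (nodeDigit g l x ρ σ s i.1 (Function.update i.2.1 i.1 i.2.2.succ) -
    nodeDigit g l x ρ σ s i.1 (Function.update i.2.1 i.1 0)) + ρ i

-- Serves twice: for the causality of Alice's wiring (dependence on `s`) and for the recovery of her
-- masks from her inputs (dependence on `ρ`).
variable {ρ s} in
theorem nodeDigit_congr {ρ' s' : PyramidBox n d → ZMod p} (k : ℕ)
    (hρ : ∀ i : PyramidBox n d, (i.1 : ℕ) < k → ρ' i = ρ i)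
    (hs : ∀ i : PyramidBox n d, (i.1 : ℕ) < k → s' i = s i) (w : Fin n → Fin (d + 1)) :
    nodeDigit g l x ρ' σ s' k w = nodeDigit g l x ρ σ s k w := by
  induction k generalizing w with
  | zero => rfl
  | succ k ih =>
    have ih' := ih (fun i hi => hρ i (by omega)) (fun i hi => hs i (by omega))
    simp only [nodeDigit]
    split_ifs with hk
    · simp only [ih', hρ (⟨k, hk⟩, _, _) (Nat.lt_succ_self k), hs (⟨k, hk⟩, _, _) (Nat.lt_succ_self k)]
    · exact ih' w

/-- The dependence is triangular: an input is its own mask plus a quantity that involves only masks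
of lower levels, so the masks can be read off level by level. -/
theorem pyramidInput_bijective [NeZero p] :
    Function.Bijective fun ρ => pyramidInput g l x ρ σ s := by
  refine Finite.injective_iff_bijective.mp fun ρ ρ' h => ?_
  have key : ∀ (k : ℕ) (i : PyramidBox n d), (i.1 : ℕ) = k → ρ i = ρ' i := by
    intro k
    induction k using Nat.strong_induction_on with
    | _ k ih =>
      intro i hi
      have hc := nodeDigit_congr g l x σ (ρ := ρ') (ρ' := ρ) (s := s) (s' := s) i.1
        (fun j hj => ih j.1 (hi ▸ hj) j rfl) (fun _ _ => rfl)
      have hi' := congrFun h i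
      simp only [pyramidInput, hc] at hi'
      exact add_left_cancel hi'
  exact funext fun i => key _ i rfl

/-- The node at level `k` above the leaf `y`. -/
def ancestor (y : Fin n → Fin (d + 1)) (k : ℕ) : Fin n → Fin (d + 1) :=
  -- Zeroing the coordinates below `k` gives all leaves under a node the same label; level `0` is
  -- `y` itself and level `n` is the root `0`.
  fun j => if (j : ℕ) < k then 0 else y j

/-- The boxes that are relevant for the retrieval of leaf `y`. -/
def pathBox (y : Fin n → Fin (d + 1)) : Fin n × Fin d ↪ PyramidBox n d where
  toFun ka := (ka.1, ancestor y (ka.1 + 1), ka.2)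
  inj' := by
    rintro ⟨k, a⟩ ⟨k', a'⟩ h
    simp only [Prod.mk.injEq] at h
    exact Prod.ext h.1 h.2.2

/-- Bob's unmasked input to box `i`. -/
def selector (p : ℕ) (y : Fin n → Fin (d + 1)) (i : PyramidBox n d) : ZMod p :=
  if y i.1 = i.2.2.succ then 1 else 0

variable {g l} in
/-- From the digit of the root, Bob obtains the digit of leaf `y` up to the sum of the shifts. -/
theorem nodeDigit_root_sub (hl : l ≠ 0) [Fact p.Prime] {h : ZMod p → ZMod p}
    {f : ZMod p → ZMod p → ZMod p} (hf : ∀ x y, f x y = g x + h y + l * x * y)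
    (t : PyramidBox n d → ZMod p) (y : Fin n → Fin (d + 1)) :
    nodeDigit g l x ρ σ s n 0 - ∑ ka, (t (pathBox y ka) +
        h (selector p y (pathBox y ka) + σ (pathBox y ka)) +
        l * ρ (pathBox y ka) * selector p y (pathBox y ka)) =
      x y - ∑ ka, (f (pyramidInput g l x ρ σ s (pathBox y ka))
        (selector p y (pathBox y ka) + σ (pathBox y ka)) - s (pathBox y ka) +
          t (pathBox y ka)) := by
  set A := nodeDigit g l x ρ σ s with hA
  -- One descent along the path costs Bob's known correction and the shifts of the `d` boxes at that
  -- node; summing over `k` telescopes from leaf to root.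
  have hstep : ∀ k : Fin n, A (k + 1) (ancestor y (k + 1)) - A k (ancestor y k) =
      ∑ a : Fin d, ((t (pathBox y (k, a)) +
        h (selector p y (pathBox y (k, a)) + σ (pathBox y (k, a))) +
        l * ρ (pathBox y (k, a)) * selector p y (pathBox y (k, a))) -
        (f (pyramidInput g l x ρ σ s (pathBox y (k, a)))
        (selector p y (pathBox y (k, a)) + σ (pathBox y (k, a))) - s (pathBox y (k, a)) +
          t (pathBox y (k, a)))) := by
    intro k
    have hanc : ancestor y k = Function.update (ancestor y (k + 1)) k (y k) := by
      funext j
      rcases eq_or_ne j k with rfl | hj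
      · simp [ancestor]
      · have hj' : (j : ℕ) ≠ k := fun h => hj (Fin.ext h)
        simp only [ancestor, Function.update_of_ne hj]
        congr 1
        exact propext (by omega)
    -- The selector picks at most one difference, and none when the wanted child is child `0`, which
    -- is the reference.
    have hsel : ∑ a : Fin d, (A k (Function.update (ancestor y (k + 1)) k a.succ) -
          A k (Function.update (ancestor y (k + 1)) k 0)) * selector p y (pathBox y (k, a)) =
        A k (ancestor y k) - A k (Function.update (ancestor y (k + 1)) k 0) := by
      rw [hanc]
      have hite : ∀ a, selector p y (pathBox y (k, a)) = if y k = a.succ then 1 else 0 :=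
        fun _ => rfl
      simp only [hite, mul_ite, mul_one, mul_zero]
      rcases Fin.eq_zero_or_eq_succ (y k) with h0 | ⟨b, hb⟩
      · simp [h0, (Fin.succ_ne_zero _).symm]
      · simp [hb]
    have hunfold : A (k + 1) (ancestor y (k + 1)) =
        A k (Function.update (ancestor y (k + 1)) k 0) + ∑ a : Fin d,
          (s (pathBox y (k, a)) - g (pyramidInput g l x ρ σ s (pathBox y (k, a))) -
            l * pyramidInput g l x ρ σ s (pathBox y (k, a)) * σ (pathBox y (k, a))) := by
      rw [hA, nodeDigit, dif_pos k.2]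
      rfl
    rw [hunfold, add_sub_right_comm, ← neg_sub, ← hsel, neg_add_eq_sub, ← Finset.sum_sub_distrib]
    refine Finset.sum_congr rfl fun a _ => ?_
    have hin : l * pyramidInput g l x ρ σ s (pathBox y (k, a)) =
        A k (Function.update (ancestor y (k + 1)) k a.succ) -
          A k (Function.update (ancestor y (k + 1)) k 0) + l * ρ (pathBox y (k, a)) := by
      rw [pyramidInput, mul_add, mul_inv_cancel_left₀ hl]
      rfl
    rw [hf]
    -- In `l * X * (selector + σ)` the `σ` part was removed by Alice; the selector part is the
    -- selected difference plus `l * ρ * selector`, which Bob knows.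
    linear_combination selector p y (pathBox y (k, a)) * hin
  have htel := Finset.sum_range_sub (fun k => A k (ancestor y k)) n
  rw [← Fin.sum_univ_eq_sum_range
      (fun k => A (k + 1) (ancestor y (k + 1)) - A k (ancestor y k)) n,
    Finset.sum_congr rfl fun k _ => hstep k, ← Fintype.sum_prod_type', Finset.sum_sub_distrib] at htel
  have hn : ancestor y n = 0 := by
    funext j
    simp [ancestor]
  have h0 : ancestor y 0 = y := by
    funext j
    simp [ancestor]
  rw [hn, h0] at htel
  have hx : A 0 y = x y := rfl
  rw [hx] at htel
  linear_combination -htel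

end Pyramid

/-! ### The random access protocol and its error law -/

/-- The random access protocol for `N = (d + 1) ^ n` digits in which Alice compresses her digits
level by level, using copies of the box `P` as noisy multipliers. -/
noncomputable def pyramidProtocol {p : ℕ} [NeZero p] {W : Set (Box p)} {P : Box p} (hP : P ∈ W)
    (g h : ZMod p → ZMod p) (l : ZMod p) {n d N : ℕ} (E : Fin N ≃ (Fin n → Fin (d + 1))) :
    RACProtocol W N 1 where
  ι := PyramidBox n d
  fintypeι := inferInstance
  decEqι := inferInstance
  box _ := P
  box_mem _ := hP
  R := (PyramidBox n d → ZMod p) × (PyramidBox n d → ZMod p)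
  fintypeR := inferInstance
  weight _ := (1 / (p : ℝ) ^ 2) ^ Fintype.card (PyramidBox n d)
  weight_nonneg _ := by positivity
  weight_sum := by
    have hp0 : (p : ℝ) ≠ 0 := by exact_mod_cast NeZero.ne p
    rw [Finset.sum_const, Finset.card_univ, Fintype.card_prod, Fintype.card_fun, ZMod.card,
      nsmul_eq_mul]
    push_cast
    rw [← mul_pow, ← mul_pow]
    field_simp
    simp
  alice r x :=
    -- Alice works upwards through the levels, since her inputs at a level need the outputs below
    -- it; Bob's inputs depend on no output.
    { time := fun _ i => i.1
      input := fun s => pyramidInput g l (x ∘ E.symm) r.1 r.2 s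
      causal := fun s s' i hs => ⟨rfl, by
        simp only [pyramidInput, nodeDigit_congr g l (x ∘ E.symm) r.2 (ρ := r.1) i.1
          (fun _ _ => rfl) hs]⟩ }
  message r x s := fun _ => nodeDigit g l (x ∘ E.symm) r.1 r.2 s n 0
  bob r y _ :=
    { time := fun _ _ => 0
      input := fun _ i => selector p (E y) i + r.2 i
      causal := fun _ _ _ _ => ⟨rfl, rfl⟩ }
  guess r y m t := m 0 - ∑ ka, (t (pathBox (E y) ka) +
    h (selector p (E y) (pathBox (E y) ka) + r.2 (pathBox (E y) ka)) +
    l * r.1 (pathBox (E y) ka) * selector p (E y) (pathBox (E y) ka))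

theorem pyramidProtocol_guessProb {p : ℕ} [Fact p.Prime] {W : Set (Box p)} {P : Box p}
    (hP : P ∈ W) {f : ZMod p → ZMod p → ZMod p} {g h : ZMod p → ZMod p} {l : ZMod p} (hl : l ≠ 0)
    (hf : ∀ x y, f x y = g x + h y + l * x * y) {n d N : ℕ}
    (E : Fin N ≃ (Fin n → Fin (d + 1))) (x : Fin N → ZMod p) (y : Fin N) (v : ZMod p) :
    charSum (boxShift P f) (n * d) (v - x y) =
      ((pyramidProtocol hP g h l E).guessProb x y v : ℂ) := by
  rw [charSum_eq_sum_prod (pathBox (E y)) (sum_boxShift P f) (by simp)]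
  congr 1
  have hmain := sum_prod_prob_eq_sum_prod_boxShift P f
    (fun ρ σ s => pyramidInput g l (x ∘ E.symm) ρ σ s)
    (fun σ s => pyramidInput_bijective g l (x ∘ E.symm) σ s) (selector p (E y))
    (fun j => if ∑ ka, j (pathBox (E y) ka) = -(v - x y) then 1 else 0)
  simp only [ite_mul, one_mul, zero_mul] at hmain
  rw [← hmain]
  refine Finset.sum_congr rfl fun r _ => congrArg _ ?_
  refine Finset.sum_congr rfl fun s _ => Finset.sum_congr rfl fun t _ => ?_
  have hg : (pyramidProtocol hP g h l E).guess r y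
      ((pyramidProtocol hP g h l E).message r x s) t = _ :=
    nodeDigit_root_sub (x ∘ E.symm) r.1 r.2 s hl hf t (E y)
  rw [hg]
  refine if_congr ?_ rfl rfl
  rw [Function.comp_apply, Equiv.symm_apply_apply, neg_sub, sub_eq_iff_eq_add, eq_sub_iff_add_eq,
    add_comm, eq_comm]

theorem card_filter_apply_eq {V : Type*} [Fintype V] [DecidableEq V] {N : ℕ} (i : Fin N) (u : V) :
    #{x : Fin N → V | x i = u} * Fintype.card V = Fintype.card V ^ N := by
  have h : (univ.filter fun x : Fin N → V => x i = u) =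
      Fintype.piFinset fun k => if k = i then {u} else univ := by
    ext x
    simp only [Finset.mem_filter, Finset.mem_univ, true_and, Fintype.mem_piFinset]
    refine ⟨fun hx k => ?_, fun hx => by simpa using hx i⟩
    split_ifs with hk
    · simp [hk, hx]
    · simp
  rw [h, Fintype.card_piFinset, ← Finset.mul_prod_erase univ _ (mem_univ i),
    Finset.prod_congr rfl fun k hk => by rw [if_neg (Finset.ne_of_mem_erase hk)]]
  simp only [if_true, Finset.card_singleton, one_mul, Finset.prod_const, Finset.card_univ,
    Finset.card_erase_of_mem (mem_univ i), Fintype.card_fin]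
  rw [← pow_succ, Nat.sub_add_cancel i.pos]

/-! ### The bound from information causality -/

theorem charSum_boxShift_le {p : ℕ} [Fact p.Prime] {W : Set (Box p)}
    (hIC : InformationCausality W) {f : ZMod p → ZMod p → ZMod p} (hf : ¬ AdditivelySeparable f)
    (hdeg : mixedDegree f = 2) {P : Box p} (hP : P ∈ W) {n d N : ℕ} (hN : N = (d + 1) ^ n)
    (c : ZMod p) :
    (charSum (boxShift P f) (n * d) c).im = 0 ∧
      (charSum (boxShift P f) (n * d) c).re ≤ fanoTInv p (((N : ℝ) - 1) / N * Real.log p) := by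
  have hp : 2 ≤ p := (Fact.out : p.Prime).two_le
  have hp0 : (p : ℝ) ≠ 0 := by positivity
  have hN0 : 0 < N := hN ▸ by positivity
  have hNR : (1 : ℝ) ≤ N := by exact_mod_cast hN0
  have hlog : 0 ≤ Real.log p := Real.log_natCast_nonneg p
  obtain ⟨g, h, l, hl, hfl⟩ := exists_eq_add_add_mul_of_mixedDegree_eq_two hf hdeg
  let E : Fin N ≃ (Fin n → Fin (d + 1)) := Fintype.equivOfCardEq (by simp [hN])
  let π := pyramidProtocol hP g h l E
  -- `μ e` is the probability that Alice's digit minus Bob's guess equals `e`.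
  let μ : ZMod p → ℝ := fun e => (charSum (boxShift P f) (n * d) (-e)).re
  have hguess : ∀ x y v, charSum (boxShift P f) (n * d) (v - x y) = (π.guessProb x y v : ℂ) :=
    pyramidProtocol_guessProb hP hl hfl E
  have hμ : ∀ e, charSum (boxShift P f) (n * d) (-e) = (μ e : ℂ) ∧ 0 ≤ μ e := by
    intro e
    have h1 := charSum_eq_sum_prod (pathBox (E ⟨0, hN0⟩)) (sum_boxShift P f) (M := n * d)
      (by simp) (-e)
    refine ⟨by simp only [μ, h1, Complex.ofReal_re], ?_⟩
    simp only [μ, h1, Complex.ofReal_re]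
    refine Finset.sum_nonneg fun j _ => ?_
    split_ifs
    exacts [Finset.prod_nonneg fun i _ => boxShift_nonneg P f _, le_rfl]
  have hsum : ∑ e, μ e = 1 := by
    have h1 : ∀ e, μ e = _ := fun e => congrArg Complex.re
      (charSum_eq_sum_prod (pathBox (E ⟨0, hN0⟩)) (sum_boxShift P f) (M := n * d) (by simp) (-e))
    simp only [h1, Complex.ofReal_re, neg_neg]
    rw [Finset.sum_comm]
    simp only [Finset.sum_ite_eq, Finset.mem_univ, if_true]
    rw [← Fintype.piFinset_univ, ← Finset.prod_univ_sum]
    simp [sum_boxShift]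
  have hjoint : ∀ i, π.joint i = fun u v => 1 / (Fintype.card (ZMod p) : ℝ) * μ (u - v) := by
    intro i
    funext u v
    have h1 : ∀ x : Fin N → ZMod p, (if x i = u then π.guessProb x i v else 0) =
        if x i = u then μ (u - v) else 0 := by
      intro x
      split_ifs with hx
      · simp only [μ, ← hx, neg_sub, hguess x i v, Complex.ofReal_re]
      · rfl
    have h2 : (#{x : Fin N → ZMod p | x i = u} : ℝ) * p = (p : ℝ) ^ N := by
      have := card_filter_apply_eq i u
      rw [ZMod.card] at this
      exact_mod_cast this
    rw [RACProtocol.joint, Finset.sum_congr rfl fun x _ => h1 x, ← Finset.sum_filter,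
      Finset.sum_const, nsmul_eq_mul, ← h2, ZMod.card]
    have h3 : (#{x : Fin N → ZMod p | x i = u} : ℝ) ≠ 0 := by
      intro h0
      rw [h0, zero_mul] at h2
      exact pow_ne_zero N hp0 h2.symm
    field_simp
  have hinfo := hIC N 1 π
  rw [Finset.sum_congr rfl fun i _ => (congrArg mutualInfo (hjoint i)).trans
    (mutualInfo_of_sub hsum)] at hinfo
  simp only [Finset.sum_const, Finset.card_univ, Fintype.card_fin,
    nsmul_eq_mul, ZMod.card, Nat.cast_one, one_mul] at hinfo
  -- Fano's inequality may be applied at any error value, not only the likeliest; this yields the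
  -- bound for every `c`.
  have hfano := sum_negMulLog_le_fanoT hp (ZMod.card p) (fun e => (hμ e).2) hsum (-c)
  have hc : charSum (boxShift P f) (n * d) c = (μ (-c) : ℂ) := by
    rw [← (hμ (-c)).1, neg_neg]
  rw [hc, Complex.ofReal_im, Complex.ofReal_re]
  refine ⟨rfl, le_fanoTInv hp ?_ ⟨?_, ?_⟩ ?_⟩
  · rw [← hsum]
    exact Finset.single_le_sum (fun e _ => (hμ e).2) (Finset.mem_univ (-c))
  · exact mul_nonneg (div_nonneg (by linarith) (by linarith)) hlog
  · exact mul_le_of_le_one_left hlog ((div_le_one (by linarith)).mpr (by linarith))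
  · refine le_trans ?_ hfano
    rw [div_mul_eq_mul_div, div_le_iff₀ (by linarith)]
    linarith

theorem theorem4 {p : ℕ} [Fact p.Prime] (W : Set (Box p))
    (hns : ∀ Q ∈ W, Q.NoSignalling) (hIC : InformationCausality W)
    (f : ZMod p → ZMod p → ZMod p) (hf : ¬ AdditivelySeparable f) (hdeg : mixedDegree f = 2)
    (P : Box p) (hP : P ∈ W) :
    (∀ N : ℕ, 1 ≤ N → N ≤ p → ∀ c : ZMod p,
      (charSum (boxShift P f) (N - 1) c).im = 0 ∧
      (charSum (boxShift P f) (N - 1) c).re ≤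
        fanoTInv p (((N : ℝ) - 1) / N * Real.log p)) ∧
    (∀ n : ℕ, 1 ≤ n → ∀ N : ℕ, N = p ^ n → ∀ c : ZMod p,
      (charSum (boxShift P f) (n * (p - 1)) c).im = 0 ∧
      (charSum (boxShift P f) (n * (p - 1)) c).re ≤
        fanoTInv p (((N : ℝ) - 1) / N * Real.log p)) := by
  constructor
  -- A single level with `N - 1` boxes.
  · intro N hN _ c
    have := charSum_boxShift_le hIC hf hdeg hP (n := 1) (d := N - 1) (N := N)
      (by rw [pow_one, Nat.sub_add_cancel hN]) c
    rwa [one_mul] at this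
  -- A pyramid of `n` levels with `p` children per node.
  · intro n _ N hN c
    refine charSum_boxShift_le hIC hf hdeg hP (d := p - 1) ?_ c
    rw [hN, Nat.sub_add_cancel (Fact.out : p.Prime).one_le]
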